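/- All Banach spaces are real. A \emph{rational Banach space} is $\mathbb R^n$ ($n\ge 0$) with a norm whose closed unit ball is the convex hull of finitely many vectors with rational coordinates; a linear operator $T:\mathbb R^n\to\mathbb R^m$ is \emph{rational} if $T[\mathbb Q^n]\subseteq\mathbb Q^m$. Let $\mathfrak F$ be the (countable) category whose objects are the rational Banach spaces and whose arrows $E\to F$ are the pairs $\langle e,P\rangle$ of rational linear operators $e:E\to F$, $P:F\to E$ such that $e$ is an isometric embedding, $\|P\|\le 1$ and $P\circ e=\mathrm{id}_E$; composition is $\langle e',P'\rangle\circ\langle e,P\rangle=\langle e'\circ e,\,P\circ P'\rangle$. A sequence $(U_n)_{n\in\mathbb N}$ in $\mathfrak F$ (a functor from the ordered set $\mathbb N$ to $\mathfrak F$) is called a \emph{Fraïssé sequence} if for every $n$ and every $\mathfrak F$-arrow $f:U_n\to Y$ there are $m>n$ and an $\mathfrak F$-arrow $g:Y\to U_m$ such that $g\circ f$ is the bonding arrow from $U_n$ to $U_m$. Let $(U_n)_{n\in\mathbb N}$ be a Fraïssé sequence in $\mathfrak F$ and let $\mathbf P$ be the completion of the union (direct limit) of the chain of the spaces $U_n$,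 formed along the embedding components of the bonding arrows. A Banach space $X$ has a \emph{monotone FDD} if there are bounded finite-rank linear operators $P_n:X\to X$ ($n\ge 0$) with $P_nP_m=0$ for $n\ne m$, with $x=\sum_{n=0}^\infty P_nx$ for every $x\in X$, and with $\|P_0+\dots+P_{n-1}\|\le 1$ for all $n$. A subspace $Y$ of a Banach space $Z$ is \emph{$1$-complemented} in $Z$ if there is a linear projection of $Z$ onto $Y$ of norm at most $1$. \textbf{Theorem (Universality).} For every Banach space $X$ with a monotone FDD there exists a linear isometric embedding $e:X\to\mathbf P$ such that $e[X]$ is $1$-complemented in $\mathbf P$. -/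

import Mathlib

open CategoryTheory Filter Topology

/-- A rational Banach space: `ℝ ^ dim` with a norm whose closed unit ball is the convex hull of
finitely many vectors with rational coordinates. -/
structure RationalSpace where
  dim : ℕ
  normFun : Seminorm ℝ (Fin dim → ℝ)
  definite : ∀ x, normFun x = 0 → x = 0
  polyhedral : ∃ s : Finset (Fin dim → ℚ),
    normFun.closedBall 0 1 =
      convexHull ℝ ((fun (v : Fin dim → ℚ) (i : Fin dim) => (v i : ℝ)) '' (s : Set (Fin dim → ℚ)))

namespace RationalSpace

/-- The underlying vector space `ℝ ^ dim`, as a type of its own so that it carries the norm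
`normFun` and not the supremum norm. -/
def Carrier (V : RationalSpace) : Type := Fin V.dim → ℝ

instance instAddCommGroup (V : RationalSpace) : AddCommGroup V.Carrier :=
  inferInstanceAs (AddCommGroup (Fin V.dim → ℝ))

instance instModule (V : RationalSpace) : Module ℝ V.Carrier :=
  inferInstanceAs (Module ℝ (Fin V.dim → ℝ))

instance instFiniteDimensional (V : RationalSpace) : FiniteDimensional ℝ V.Carrier :=
  inferInstanceAs (FiniteDimensional ℝ (Fin V.dim → ℝ))

instance instNorm (V : RationalSpace) : Norm V.Carrier := ⟨fun x => V.normFun x⟩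

theorem normedSpaceCore (V : RationalSpace) : NormedSpace.Core ℝ V.Carrier where
  norm_nonneg x := apply_nonneg V.normFun x
  norm_smul c x := map_smul_eq_mul V.normFun c x
  norm_triangle x y := map_add_le_add V.normFun x y
  norm_eq_zero_iff x := ⟨V.definite x, fun h => by subst h; exact map_zero V.normFun⟩

noncomputable instance instNormedAddCommGroup (V : RationalSpace) :
    NormedAddCommGroup V.Carrier :=
  NormedAddCommGroup.ofCore V.normedSpaceCore

noncomputable instance instNormedSpace (V : RationalSpace) : NormedSpace ℝ V.Carrier :=
  NormedSpace.ofCore V.normedSpaceCore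

/-- The vector with the given rational coordinates. -/
def ofRat (V : RationalSpace) (v : Fin V.dim → ℚ) : V.Carrier := fun i => (v i : ℝ)

/-- A map between rational spaces is rational if it maps rational vectors to rational vectors. -/
def IsRationalMap {V W : RationalSpace} (T : V.Carrier → W.Carrier) : Prop :=
  ∀ v : Fin V.dim → ℚ, ∃ w : Fin W.dim → ℚ, T (V.ofRat v) = W.ofRat w

end RationalSpace

/-- A projection–embedding pair from `E` to `F`: a linear isometric embedding `emb : E → F` and a
linear operator `proj : F → E` of norm at most one with `proj ∘ emb = id`. -/
@[ext]
structure ProjEmbPair (E F : Type*) [NormedAddCommGroup E] [NormedSpace ℝ E]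
    [NormedAddCommGroup F] [NormedSpace ℝ F] where
  emb : E →ₗᵢ[ℝ] F
  proj : F →L[ℝ] E
  norm_proj_le : ‖proj‖ ≤ 1
  proj_emb : ∀ x, proj (emb x) = x

namespace ProjEmbPair

/-- The identity pair. -/
noncomputable def id (E : Type*) [NormedAddCommGroup E] [NormedSpace ℝ E] : ProjEmbPair E E where
  emb := LinearIsometry.id
  proj := ContinuousLinearMap.id ℝ E
  norm_proj_le := ContinuousLinearMap.norm_id_le
  proj_emb _ := rfl

/-- Composition of pairs (in diagrammatic order): embeddings compose forwards, projections
compose backwards. -/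
noncomputable def comp {E F G : Type*} [NormedAddCommGroup E] [NormedSpace ℝ E]
    [NormedAddCommGroup F] [NormedSpace ℝ F] [NormedAddCommGroup G] [NormedSpace ℝ G]
    (f : ProjEmbPair E F) (g : ProjEmbPair F G) : ProjEmbPair E G where
  emb := g.emb.comp f.emb
  proj := f.proj.comp g.proj
  norm_proj_le := (ContinuousLinearMap.opNorm_comp_le _ _).trans
    (mul_le_one₀ f.norm_proj_le (norm_nonneg _) g.norm_proj_le)
  proj_emb x := by simp [g.proj_emb, f.proj_emb]

end ProjEmbPair

/-- An arrow between rational spaces: a projection–embedding pair with both components rational. -/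
@[ext]
structure RationalPair (V W : RationalSpace) extends ProjEmbPair V.Carrier W.Carrier where
  emb_rational : RationalSpace.IsRationalMap emb
  proj_rational : RationalSpace.IsRationalMap proj

/-- The category of rational spaces and rational projection–embedding pairs. -/
noncomputable instance RationalSpace.instCategory : Category RationalSpace where
  Hom V W := RationalPair V W
  id V :=
    { toProjEmbPair := ProjEmbPair.id V.Carrier
      emb_rational := fun v => ⟨v, rfl⟩
      proj_rational := fun v => ⟨v, rfl⟩ }
  comp {V W Z} f g :=
    { toProjEmbPair := f.toProjEmbPair.comp g.toProjEmbPair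
      emb_rational := fun v => by
        obtain ⟨w, hw⟩ := f.emb_rational v
        obtain ⟨z, hz⟩ := g.emb_rational w
        refine ⟨z, ?_⟩
        change g.emb (f.emb (V.ofRat v)) = _
        rw [hw, hz]
      proj_rational := fun v => by
        obtain ⟨w, hw⟩ := g.proj_rational v
        obtain ⟨z, hz⟩ := f.proj_rational w
        refine ⟨z, ?_⟩
        change f.proj (g.proj (Z.ofRat v)) = _
        rw [hw, hz] }

/-- A sequence (a functor from the poset `ℕ`) of rational projection–embedding pairs is a
Fraïssé sequence if each arrow out of one of its terms can be continued to a bonding arrow. -/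
def IsFraisseSequence (U : ℕ ⥤ RationalSpace) : Prop :=
  ∀ (n : ℕ) (Y : RationalSpace) (f : U.obj n ⟶ Y),
    ∃ (m : ℕ) (h : n < m) (g : Y ⟶ U.obj m), f ≫ g = U.map (homOfLE h.le)

section Limit

/-- The bonding embeddings `U n → U m` of a sequence. -/
noncomputable def bondEmb (U : ℕ ⥤ RationalSpace) (n m : ℕ) (h : n ≤ m) :
    (U.obj n).Carrier →ₗᵢ[ℝ] (U.obj m).Carrier :=
  RationalPair.toProjEmbPair (U.map (homOfLE h)) |>.emb

instance bondEmb_directedSystem (U : ℕ ⥤ RationalSpace) :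
    DirectedSystem (fun n => (U.obj n).Carrier) (fun n m h => bondEmb U n m h) where
  map_self n x := by
    have h : U.map (homOfLE (le_refl n)) = 𝟙 (U.obj n) := U.map_id n
    change (RationalPair.toProjEmbPair (U.map (homOfLE (le_refl n)))).emb x = x
    rw [h]; rfl
  map_map k j i hij hjk x := by
    have h : U.map (homOfLE (hij.trans hjk)) = U.map (homOfLE hij) ≫ U.map (homOfLE hjk) :=
      U.map_comp (homOfLE hij) (homOfLE hjk)
    change _ = (RationalPair.toProjEmbPair (U.map (homOfLE (hij.trans hjk)))).emb x
    rw [h]; rfl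

/-- The union of the chain: the direct limit of the spaces `U n` along the bonding embeddings. -/
def ChainUnion (U : ℕ ⥤ RationalSpace) : Type :=
  DirectLimit (fun n => (U.obj n).Carrier) (bondEmb U)

namespace ChainUnion

noncomputable instance instAddCommGroup (U : ℕ ⥤ RationalSpace) : AddCommGroup (ChainUnion U) :=
  inferInstanceAs (AddCommGroup (DirectLimit (fun n => (U.obj n).Carrier) (bondEmb U)))

noncomputable instance instModule (U : ℕ ⥤ RationalSpace) : Module ℝ (ChainUnion U) :=
  inferInstanceAs (Module ℝ (DirectLimit (fun n => (U.obj n).Carrier) (bondEmb U)))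

/-- The norm of the union restricts to the norm of each `U n`. -/
noncomputable instance instNorm (U : ℕ ⥤ RationalSpace) : Norm (ChainUnion U) :=
  ⟨DirectLimit.lift (bondEmb U) (fun _ x => ‖x‖)
    (fun n m h x => ((bondEmb U n m h).norm_map x).symm)⟩

theorem normedSpaceCore (U : ℕ ⥤ RationalSpace) : NormedSpace.Core ℝ (ChainUnion U) where
  norm_nonneg x := by
    induction x using DirectLimit.induction with
    | ih n x => exact norm_nonneg x
  norm_smul c x := by
    induction x using DirectLimit.induction with
    | ih n x => exact norm_smul c x
  norm_triangle x y := by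
    induction x, y using DirectLimit.induction₂ with
    | ih n x y =>
      have h := DirectLimit.add_def (f := bondEmb U) n x y
      refine le_of_eq_of_le (congrArg (fun z : ChainUnion U => ‖z‖) h) (norm_add_le x y)
  norm_eq_zero_iff x := by
    have h0 : ∀ n, (0 : ChainUnion U) = (⟦⟨n, 0⟩⟧ : DirectLimit _ (bondEmb U)) :=
      fun n => DirectLimit.zero_def (f := bondEmb U) n
    constructor
    · induction x using DirectLimit.induction with
      | ih n x =>
        intro h
        have hx : x = 0 := norm_eq_zero.mp h
        rw [hx, h0 n]
    · rintro rfl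
      rw [h0 0]
      exact norm_zero (E := (U.obj 0).Carrier)

noncomputable instance instNormedAddCommGroup (U : ℕ ⥤ RationalSpace) :
    NormedAddCommGroup (ChainUnion U) :=
  NormedAddCommGroup.ofCore (normedSpaceCore U)

noncomputable instance instNormedSpace (U : ℕ ⥤ RationalSpace) : NormedSpace ℝ (ChainUnion U) :=
  NormedSpace.ofCore (normedSpaceCore U)

end ChainUnion

/-- The Banach space determined by a sequence: the completion of the union of its chain. -/
abbrev LimitSpace (U : ℕ ⥤ RationalSpace) : Type := UniformSpace.Completion (ChainUnion U)

end Limit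

/-- `X` has a monotone finite-dimensional decomposition: there are finite-rank operators `P n`,
pairwise orthogonal, with `x = ∑ P n x` (convergence of the partial sums in norm) for every `x`,
all of whose partial sums `P 0 + ⋯ + P (n - 1)` have norm at most one. -/
def HasMonotoneFDD (X : Type*) [NormedAddCommGroup X] [NormedSpace ℝ X] : Prop :=
  ∃ P : ℕ → X →L[ℝ] X,
    (∀ n, FiniteDimensional ℝ (LinearMap.range (P n : X →ₗ[ℝ] X))) ∧
    (∀ n m, n ≠ m → ∀ x, P n (P m x) = 0) ∧
    (∀ x, Tendsto (fun N => ∑ n ∈ Finset.range N, P n x) atTop (𝓝 x)) ∧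
    (∀ N, ‖∑ n ∈ Finset.range N, P n‖ ≤ 1)

/-- A subspace is 1-complemented if it is the range of a linear projection of norm at most one. -/
def IsOneComplemented {X : Type*} [NormedAddCommGroup X] [NormedSpace ℝ X]
    (Y : Submodule ℝ X) : Prop :=
  ∃ R : X →L[ℝ] X, ‖R‖ ≤ 1 ∧ (∀ x, R x ∈ Y) ∧ ∀ y ∈ Y, R y = y

/-!
# Complementable universality of the limit of a Fraïssé sequence

Let `S n` be the partial sums of a monotone FDD of `X`. The idea is to map the chain of the spaces
`S n X` into the Fraïssé sequence step by step, with errors that are summable, and to pass to the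
limit both on the embeddings and on the projections.

The ranges `S n X` have adapted coordinates in which the inclusions and the operators `S n` are
given by rational matrices (`exists_coordinates`). Between the unit ball of a finite-dimensional
normed space and a slightly smaller copy of it there is a rational polytope
(`exists_rational_polytope`), so there are rational spaces `V n` and contractions `J n : V n → X`,
`K n : X → V n` with `J n ∘ K n = (1 - δ n) S n` and `K n ∘ J n = (1 - δ n) id`
(`exists_rationalSpace_sequence`). The contractions `K (n + 1) ∘ J n` and `K n ∘ J (n + 1)` thus
form an arrow `V n → V (n + 1)` up to a small error.

The main tool is an approximate amalgamation (`exists_approximate_amalgam`): an arrow `V n → U k`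
and such an almost-arrow `V n → V (n + 1)` fit into a rational space `Y` whose unit ball is a
convex hull of finitely many explicit vectors. The Fraïssé property then sends `Y` back into the
sequence, and iterating this gives arrows `f n : V n → U (k n)`
(`IsFraisseSequence.exists_arrows`).

The operators `f n ∘ K n : X → P` converge pointwise on the dense union of the `S n X`, because the
embeddings are almost compatible. The operators `J n ∘ (f n).proj : P → X` converge pointwise on
the union of the chain, because there the projections are exactly compatible, up to the factors
`1 - δ n`. Their composition `(1 - δ n) S n` converges to the identity, so the limits are an
isometric embedding and a contractive left inverse (`exists_isometry_isOneComplemented`).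
-/

/-! ### Rational vectors and polyhedral norms -/

/-- A real vector all of whose coordinates are rational. -/
def IsRationalVector {ι : Type*} (x : ι → ℝ) : Prop := ∀ i, ∃ q : ℚ, x i = q

namespace IsRationalVector

variable {ι : Type*} {x y : ι → ℝ}

theorem exists_eq (h : IsRationalVector x) : ∃ v : ι → ℚ, x = fun i => (v i : ℝ) := by
  choose v hv using h
  exact ⟨v, funext hv⟩

theorem ratCast (v : ι → ℚ) : IsRationalVector (fun i => (v i : ℝ)) := fun i => ⟨v i, rfl⟩

theorem zero : IsRationalVector (0 : ι → ℝ) := fun _ => ⟨0, by simp⟩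

theorem add (hx : IsRationalVector x) (hy : IsRationalVector y) : IsRationalVector (x + y) :=
  fun i => by
    obtain ⟨p, hp⟩ := hx i
    obtain ⟨q, hq⟩ := hy i
    exact ⟨p + q, by simp [hp, hq]⟩

theorem smul (hx : IsRationalVector x) (r : ℚ) : IsRationalVector ((r : ℝ) • x) :=
  fun i => by
    obtain ⟨p, hp⟩ := hx i
    exact ⟨r * p, by simp [hp]⟩

theorem neg (hx : IsRationalVector x) : IsRationalVector (-x) :=
  fun i => by
    obtain ⟨p, hp⟩ := hx i
    exact ⟨-p, by simp [hp]⟩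

theorem sumElim {κ : Type*} {z : κ → ℝ} (hx : IsRationalVector x) (hz : IsRationalVector z) :
    IsRationalVector (Sum.elim x z) := by
  rintro (i | i)
  · exact hx i
  · exact hz i

end IsRationalVector

theorem Set.Finite.exists_ratCast_image_eq {ι : Type*} {A : Set (ι → ℝ)} (hA : A.Finite)
    (hr : ∀ a ∈ A, IsRationalVector a) :
    ∃ s : Finset (ι → ℚ), (fun (v : ι → ℚ) (i : ι) => (v i : ℝ)) '' (s : Set (ι → ℚ)) = A := by
  have hinj : Function.Injective (fun (v : ι → ℚ) (i : ι) => (v i : ℝ)) := fun v w h =>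
    funext fun i => by simpa using congrFun h i
  refine ⟨(hA.preimage hinj.injOn).toFinset, ?_⟩
  rw [Set.Finite.coe_toFinset]
  refine Set.image_preimage_eq_of_subset fun a ha => ?_
  obtain ⟨v, hv⟩ := (hr a ha).exists_eq
  exact ⟨v, hv.symm⟩

theorem neg_mem_convexHull_union_neg {E : Type*} [AddCommGroup E] [Module ℝ E] {A : Set E} {x : E}
    (hx : x ∈ convexHull ℝ (A ∪ -A)) : -x ∈ convexHull ℝ (A ∪ -A) := by
  have h : -(A ∪ -A) = A ∪ -A := by simp [Set.union_neg, Set.union_comm]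
  rw [← h, convexHull_neg]
  simpa using hx

/-- The symmetric convex hull of finitely many rational vectors, if it is a neighbourhood of the
origin, is the unit ball of a rational space. The space comes with coordinates `c` indexed by an
arbitrary finite type, which identify its rational vectors with those of `ι → ℝ`. -/
theorem exists_rationalSpace_of_vertices {ι : Type*} [Fintype ι] {A : Set (ι → ℝ)} (hA : A.Finite)
    (hr : ∀ a ∈ A, IsRationalVector a) (h0 : convexHull ℝ (A ∪ -A) ∈ 𝓝 (0 : ι → ℝ)) :
    ∃ (V : RationalSpace) (c : V.Carrier ≃ₗ[ℝ] (ι → ℝ)),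
      (∀ v, IsRationalVector (c (V.ofRat v))) ∧
      (∀ x, IsRationalVector x → ∃ v, c.symm x = V.ofRat v) ∧
      ∀ x, ‖x‖ ≤ 1 ↔ c x ∈ convexHull ℝ (A ∪ -A) := by
  let n := Fintype.card ι
  let e : ι ≃ Fin n := Fintype.equivFin ι
  let c : (Fin n → ℝ) ≃L[ℝ] (ι → ℝ) := (LinearEquiv.funCongrLeft ℝ ℝ e).toContinuousLinearEquiv
  have hc : ∀ x i, c x i = x (e i) := fun x i => rfl
  have hcs : ∀ x i, c.symm x i = x (e.symm i) := fun x i => rfl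
  set H := convexHull ℝ (A ∪ -A) with hH
  let B : Set (Fin n → ℝ) := c ⁻¹' H
  have hBc : Convex ℝ B := (convex_convexHull ℝ _).linear_preimage c.toLinearMap
  have hAA : (A ∪ -A).Finite := hA.union hA.neg
  have hB0 : B ∈ 𝓝 0 := c.continuous.continuousAt.preimage_mem_nhds (by simpa using h0)
  have hBcl : IsClosed B := (hAA.isClosed_convexHull ℝ).preimage c.continuous
  have hBb : Bornology.IsVonNBounded ℝ B := by
    have : B = c.symm '' H := (c.toEquiv.image_symm_eq_preimage H).symm
    rw [this, NormedSpace.isVonNBounded_iff]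
    exact ((hAA.isCompact_convexHull ℝ).image c.symm.continuous).isBounded
  have hBal : Balanced ℝ B := by
    refine (balanced_iff_neg_mem hBc).2 fun x hx => ?_
    change c (-x) ∈ H
    rw [map_neg]
    exact neg_mem_convexHull_union_neg hx
  have habs : Absorbent ℝ B := absorbent_nhds_zero hB0
  let N := gaugeSeminorm hBal hBc habs
  have hball : ∀ x, N x ≤ 1 ↔ x ∈ B := fun x => by
    change gauge B x ≤ 1 ↔ _
    rw [gauge_le_one_iff_mem_closure hBc hB0, hBcl.closure_eq]
  have hpoly : ∃ s : Finset (Fin n → ℚ), N.closedBall 0 1 =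
      convexHull ℝ ((fun (v : Fin n → ℚ) (i : Fin n) => (v i : ℝ)) '' (s : Set (Fin n → ℚ))) := by
    obtain ⟨s, hs⟩ := (hAA.image c.symm).exists_ratCast_image_eq (by
      rintro _ ⟨a, ha, rfl⟩ i
      rw [hcs]
      rcases ha with ha | ha
      · exact hr a ha _
      · simpa using (hr _ ha).neg (e.symm i))
    refine ⟨s, ?_⟩
    rw [hs]
    ext x
    rw [Seminorm.mem_closedBall, sub_zero, hball]
    have h := c.symm.toLinearMap.image_convexHull (A ∪ -A)
    have h' : c.symm '' H = B := c.toEquiv.image_symm_eq_preimage H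
    exact (Set.ext_iff.1 (h'.symm.trans h) x)
  refine ⟨⟨n, N, fun x hx => (gauge_eq_zero habs hBb).1 hx, hpoly⟩, c.toLinearEquiv, ?_, ?_, ?_⟩
  · intro v i
    exact ⟨v (e i), rfl⟩
  · intro x hx
    obtain ⟨v, rfl⟩ := hx.exists_eq
    exact ⟨fun i => v (e.symm i), rfl⟩
  · exact hball

theorem RationalSpace.exists_vertices (V : RationalSpace) :
    ∃ A : Set V.Carrier, A.Finite ∧ (∀ a ∈ A, ∃ v, a = V.ofRat v) ∧
      ∀ x : V.Carrier, ‖x‖ ≤ 1 ↔ x ∈ convexHull ℝ A := by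
  obtain ⟨s, hs⟩ := V.polyhedral
  refine ⟨V.ofRat '' (s : Set _), s.finite_toSet.image _, ?_, fun x => ?_⟩
  · rintro _ ⟨v, -, rfl⟩
    exact ⟨v, rfl⟩
  · exact (V.normFun.mem_closedBall_zero (y := x)).symm.trans (Set.ext_iff.1 hs x)

theorem RationalSpace.exists_eq_ofRat_iff (V : RationalSpace) (x : V.Carrier) :
    (∃ v, x = V.ofRat v) ↔ IsRationalVector (ι := Fin V.dim) x :=
  ⟨by rintro ⟨v, rfl⟩; exact IsRationalVector.ratCast v, fun h => h.exists_eq⟩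

/-- A linear map that sends the unit ball into the unit ball is a contraction. -/
theorem LinearMap.norm_map_le_of_norm_le_one {E F : Type*} [NormedAddCommGroup E] [NormedSpace ℝ E]
    [SeminormedAddCommGroup F] [NormedSpace ℝ F] (T : E →ₗ[ℝ] F)
    (h : ∀ x, ‖x‖ ≤ 1 → ‖T x‖ ≤ 1) (x : E) : ‖T x‖ ≤ ‖x‖ := by
  rcases eq_or_ne x 0 with rfl | hx
  · simp
  · have hx' : 0 < ‖x‖ := norm_pos_iff.2 hx
    have := h (‖x‖⁻¹ • x) (by rw [norm_smul, norm_inv, norm_norm, inv_mul_cancel₀ hx'.ne'])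
    rw [map_smul, norm_smul, norm_inv, norm_norm, inv_mul_le_one₀ hx'] at this
    exact this

/-- If the unit ball of `E` is the convex hull of `A`, a linear map on `E` is a contraction as
soon as it sends `A` into the unit ball. -/
theorem LinearMap.norm_map_le_of_vertices {E F : Type*} [NormedAddCommGroup E] [NormedSpace ℝ E]
    [SeminormedAddCommGroup F] [NormedSpace ℝ F] (T : E →ₗ[ℝ] F) {A : Set E}
    (hA : ∀ x : E, ‖x‖ ≤ 1 → x ∈ convexHull ℝ A) (h : ∀ a ∈ A, ‖T a‖ ≤ 1) (x : E) :
    ‖T x‖ ≤ ‖x‖ := by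
  refine T.norm_map_le_of_norm_le_one (fun x hx => ?_) x
  have hsub : convexHull ℝ A ⊆ T ⁻¹' Metric.closedBall 0 1 :=
    convexHull_min (fun a ha => by simpa using h a ha)
      ((convex_closedBall 0 1).linear_preimage T)
  simpa using hsub (hA x hx)

/-- A rational contraction `e` with a rational contractive left inverse `p` is an arrow: `e` is
isometric since `‖x‖ = ‖p (e x)‖ ≤ ‖e x‖ ≤ ‖x‖`. -/
noncomputable def RationalPair.ofContractions {V W : RationalSpace} (e : V.Carrier →ₗ[ℝ] W.Carrier)
    (p : W.Carrier →ₗ[ℝ] V.Carrier) (he : ∀ x, ‖e x‖ ≤ ‖x‖) (hp : ∀ y, ‖p y‖ ≤ ‖y‖)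
    (hpe : ∀ x, p (e x) = x) (hre : RationalSpace.IsRationalMap e)
    (hrp : RationalSpace.IsRationalMap p) : RationalPair V W where
  emb := ⟨e, fun x => le_antisymm (he x) (by simpa [hpe] using hp (e x))⟩
  proj := p.mkContinuous 1 fun y => by simpa using hp y
  norm_proj_le := p.mkContinuous_norm_le zero_le_one _
  proj_emb := hpe
  emb_rational := hre
  proj_rational := hrp

/-! ### Approximate amalgamation -/

theorem norm_le_of_mem_vertices {ι : Type*} {V : RationalSpace} {c : V.Carrier ≃ₗ[ℝ] (ι → ℝ)}
    {A : Set (ι → ℝ)} (hc : ∀ x, ‖x‖ ≤ 1 ↔ c x ∈ convexHull ℝ (A ∪ -A)) {a : ι → ℝ} (ha : a ∈ A) :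
    ‖c.symm a‖ ≤ 1 := by
  rw [hc, c.apply_symm_apply]
  exact subset_convexHull ℝ _ (Or.inl ha)

/-- The version of `LinearMap.norm_map_le_of_vertices` for a space given by vertices `±a`, `a ∈ A`,
in coordinates `c`. -/
theorem norm_map_le_of_symm_vertices {ι : Type*} {V : RationalSpace}
    {c : V.Carrier ≃ₗ[ℝ] (ι → ℝ)} {A : Set (ι → ℝ)}
    (hc : ∀ x, ‖x‖ ≤ 1 ↔ c x ∈ convexHull ℝ (A ∪ -A)) {F : Type*} [SeminormedAddCommGroup F]
    [NormedSpace ℝ F] (T : V.Carrier →ₗ[ℝ] F) (h : ∀ a ∈ A, ‖T (c.symm a)‖ ≤ 1) (x : V.Carrier) :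
    ‖T x‖ ≤ ‖x‖ := by
  refine T.norm_map_le_of_vertices (A := c.symm '' (A ∪ -A)) (fun x hx => ?_) ?_ x
  · have h1 := c.symm.toLinearMap.image_convexHull (A ∪ -A)
    have h2 : c.symm '' (convexHull ℝ (A ∪ -A)) = convexHull ℝ (c.symm '' (A ∪ -A)) := h1
    rw [← h2]
    exact ⟨c x, (hc x).1 hx, c.symm_apply_apply x⟩
  · rintro _ ⟨a, ha | ha, rfl⟩
    · exact h a ha
    · simpa using h _ ha

/-- The unit ball of a rational space is a neighbourhood of the origin for the product topology. -/
theorem RationalSpace.unitBall_mem_nhds (V : RationalSpace) :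
    {x : Fin V.dim → ℝ | ‖(show V.Carrier from x)‖ ≤ 1} ∈ 𝓝 0 := by
  let j : (Fin V.dim → ℝ) →ₗ[ℝ] V.Carrier := ⟨⟨fun x => x, fun _ _ => rfl⟩, fun _ _ => rfl⟩
  have hj : Continuous j := j.continuous_of_finiteDimensional
  have h := hj.continuousAt.preimage_mem_nhds (x := 0)
    (by rw [map_zero]; exact Metric.closedBall_mem_nhds (0 : V.Carrier) one_pos)
  filter_upwards [h] with x hx
  exact mem_closedBall_zero_iff.1 hx

/-- Approximate amalgamation. Let `f : V → U` be an arrow, and let `s : V → W`, `t : W → V` be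
rational contractions which are almost an arrow: `t ∘ s` is `ε`-close to the identity. Then `U` and
`W` embed into a common rational space `Y` in such a way that the square commutes up to `ε` on
embeddings, while the projection `Y → W` restricted to `U` is exactly `s ∘ f.proj`.

As a vector space `Y = U × W`; its unit ball is the convex hull of the unit balls of `U` and `W` and
of the vectors `±ε⁻¹ (f v, - s v)` with `v` in the unit ball of `V`. -/
theorem exists_approximate_amalgam {V W U : RationalSpace} (f : RationalPair V U)
    (s : V.Carrier →ₗ[ℝ] W.Carrier) (t : W.Carrier →ₗ[ℝ] V.Carrier) (hs : ∀ v, ‖s v‖ ≤ ‖v‖)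
    (ht : ∀ w, ‖t w‖ ≤ ‖w‖) (hsr : RationalSpace.IsRationalMap s)
    (htr : RationalSpace.IsRationalMap t) {ε : ℚ} (hε : 0 < ε)
    (hts : ∀ v, ‖t (s v) - v‖ ≤ ε * ‖v‖) :
    ∃ (Y : RationalSpace) (g : RationalPair U Y) (h : RationalPair W Y),
      (∀ v, ‖g.emb (f.emb v) - h.emb (s v)‖ ≤ ε * ‖v‖) ∧
      ∀ u, h.proj (g.emb u) = s (f.proj u) := by
  have hε' : (0 : ℝ) < ε := by exact_mod_cast hε
  obtain ⟨AV, hAVf, hAVr, hAV⟩ := V.exists_vertices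
  obtain ⟨AW, hAWf, hAWr, hAW⟩ := W.exists_vertices
  obtain ⟨AU, hAUf, hAUr, hAU⟩ := U.exists_vertices
  let κ := Fin U.dim ⊕ Fin W.dim
  let inl : U.Carrier →ₗ[ℝ] (κ → ℝ) :=
    { toFun := fun u => Sum.elim u 0
      map_add' := fun x y => funext (Sum.rec (fun _ => rfl) fun _ => (add_zero (0 : ℝ)).symm)
      map_smul' := fun r x => funext (Sum.rec (fun _ => rfl) fun _ => (mul_zero r).symm) }
  let inr : W.Carrier →ₗ[ℝ] (κ → ℝ) :=
    { toFun := fun w => Sum.elim 0 w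
      map_add' := fun x y => funext (Sum.rec (fun _ => (add_zero (0 : ℝ)).symm) fun _ => rfl)
      map_smul' := fun r x => funext (Sum.rec (fun _ => (mul_zero r).symm) fun _ => rfl) }
  let fst : (κ → ℝ) →ₗ[ℝ] U.Carrier :=
    ⟨⟨fun x i => x (Sum.inl i), fun _ _ => rfl⟩, fun _ _ => rfl⟩
  let snd : (κ → ℝ) →ₗ[ℝ] W.Carrier :=
    ⟨⟨fun x i => x (Sum.inr i), fun _ _ => rfl⟩, fun _ _ => rfl⟩
  have fst_inl : ∀ u, fst (inl u) = u := fun u => rfl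
  have fst_inr : ∀ w, fst (inr w) = 0 := fun w => rfl
  have snd_inl : ∀ u, snd (inl u) = 0 := fun u => rfl
  have snd_inr : ∀ w, snd (inr w) = w := fun w => rfl
  have hinl : ∀ v, IsRationalVector (inl (U.ofRat v)) := fun v =>
    (IsRationalVector.ratCast v).sumElim .zero
  have hinr : ∀ v, IsRationalVector (inr (W.ofRat v)) := fun v =>
    IsRationalVector.zero.sumElim (.ratCast v)
  let d : V.Carrier →ₗ[ℝ] (κ → ℝ) := (ε : ℝ)⁻¹ • (inl ∘ₗ f.emb.toLinearMap - inr ∘ₗ s)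
  have hd : ∀ v, d v = (ε : ℝ)⁻¹ • (inl (f.emb v) - inr (s v)) := fun v => rfl
  let A : Set (κ → ℝ) := inl '' AU ∪ inr '' AW ∪ d '' AV
  have hAf : A.Finite := ((hAUf.image _).union (hAWf.image _)).union (hAVf.image _)
  have hAr : ∀ a ∈ A, IsRationalVector a := by
    rintro _ ((⟨u, hu, rfl⟩ | ⟨w, hw, rfl⟩) | ⟨v, hv, rfl⟩)
    · obtain ⟨u, rfl⟩ := hAUr u hu
      exact hinl u
    · obtain ⟨w, rfl⟩ := hAWr w hw
      exact hinr w
    · obtain ⟨v, rfl⟩ := hAVr v hv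
      obtain ⟨u, hu⟩ := f.emb_rational v
      obtain ⟨w, hw⟩ := hsr v
      rw [hd, hu, hw, sub_eq_add_neg]
      simpa using ((hinl u).add (hinr w).neg).smul ε⁻¹
  have hA0 : convexHull ℝ (A ∪ -A) ∈ 𝓝 (0 : κ → ℝ) := by
    have hl : ∀ u : U.Carrier, ‖u‖ ≤ 1 → inl u ∈ convexHull ℝ (A ∪ -A) := fun u hu => by
      have h := Set.mem_image_of_mem inl ((hAU u).1 hu)
      rw [inl.image_convexHull] at h
      exact convexHull_mono (fun x hx => .inl (.inl (.inl hx))) h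
    have hrr : ∀ w : W.Carrier, ‖w‖ ≤ 1 → inr w ∈ convexHull ℝ (A ∪ -A) := fun u hu => by
      have h := Set.mem_image_of_mem inr ((hAW u).1 hu)
      rw [inr.image_convexHull] at h
      exact convexHull_mono (fun x hx => .inl (.inl (.inr hx))) h
    -- Halving puts a small vector `(u, w)` on the segment between `(2u, 0)` and `(0, 2w)`.
    have h1 : Tendsto (fun (x : κ → ℝ) i => 2 * x (Sum.inl i)) (𝓝 0) (𝓝 (0 : Fin U.dim → ℝ)) :=
      Continuous.tendsto' (by fun_prop) _ _ (by ext; simp)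
    have h2 : Tendsto (fun (x : κ → ℝ) i => 2 * x (Sum.inr i)) (𝓝 0) (𝓝 (0 : Fin W.dim → ℝ)) :=
      Continuous.tendsto' (by fun_prop) _ _ (by ext; simp)
    filter_upwards [h1 U.unitBall_mem_nhds, h2 W.unitBall_mem_nhds] with x hx1 hx2
    have h3 := (convex_convexHull ℝ (A ∪ -A)) (hl _ hx1) (hrr _ hx2)
      (show (0 : ℝ) ≤ 1 / 2 by norm_num) (show (0 : ℝ) ≤ 1 / 2 by norm_num) (by norm_num)
    convert h3 using 1
    ext (i | i) <;> simp [inl, inr]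
  obtain ⟨Y, c, hcr, hcr', hc⟩ := exists_rationalSpace_of_vertices hAf hAr hA0
  let a : U.Carrier →ₗ[ℝ] Y.Carrier := c.symm.toLinearMap ∘ₗ inl
  let b : W.Carrier →ₗ[ℝ] Y.Carrier := c.symm.toLinearMap ∘ₗ inr
  let p : Y.Carrier →ₗ[ℝ] U.Carrier := (fst + f.emb.toLinearMap ∘ₗ t ∘ₗ snd) ∘ₗ c.toLinearMap
  let q : Y.Carrier →ₗ[ℝ] W.Carrier :=
    (s ∘ₗ (f.proj : U.Carrier →ₗ[ℝ] V.Carrier) ∘ₗ fst + snd) ∘ₗ c.toLinearMap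
  have ha : ∀ u, a u = c.symm (inl u) := fun _ => rfl
  have hb : ∀ u, b u = c.symm (inr u) := fun _ => rfl
  have hp : ∀ x, p (c.symm x) = fst x + f.emb (t (snd x)) := fun x => by
    simp [p]
  have hq : ∀ x, q (c.symm x) = s (f.proj (fst x)) + snd x := fun x => by
    simp [q]
  have hpa : ∀ u, p (a u) = u := fun u => by simp [ha, hp, fst_inl, snd_inl]
  have hqb : ∀ u, q (b u) = u := fun u => by simp [hb, hq, fst_inr, snd_inr]
  have hqa : ∀ u, q (a u) = s (f.proj u) := fun u => by simp [ha, hq, fst_inl, snd_inl]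
  have hpb : ∀ w, p (b w) = f.emb (t w) := fun u => by simp [hb, hp, fst_inr, snd_inr]
  have hproj : ∀ u, ‖f.proj u‖ ≤ ‖u‖ := fun u => by
    simpa using f.proj.le_of_opNorm_le f.norm_proj_le u
  have hdsymm : ∀ v, c.symm (d v) = (ε : ℝ)⁻¹ • (a (f.emb v) - b (s v)) := fun v => by
    rw [hd, map_smul, map_sub, ha, hb]
  have ha1 : ∀ u, ‖a u‖ ≤ ‖u‖ := a.norm_map_le_of_vertices (fun x => (hAU x).1) fun u hu =>
    norm_le_of_mem_vertices hc (.inl (.inl ⟨u, hu, rfl⟩))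
  have hb1 : ∀ u, ‖b u‖ ≤ ‖u‖ := b.norm_map_le_of_vertices (fun x => (hAW x).1) fun u hu =>
    norm_le_of_mem_vertices hc (.inl (.inr ⟨u, hu, rfl⟩))
  have hd1 : ∀ v, ‖c.symm (d v)‖ ≤ ‖v‖ :=
    (c.symm.toLinearMap ∘ₗ d).norm_map_le_of_vertices (fun x => (hAV x).1) fun u hu =>
      norm_le_of_mem_vertices hc (.inr ⟨u, hu, rfl⟩)
  have hp1 : ∀ y, ‖p y‖ ≤ ‖y‖ := norm_map_le_of_symm_vertices hc p (by
    rintro _ ((⟨u, hu, rfl⟩ | ⟨w, hw, rfl⟩) | ⟨v, hv, rfl⟩)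
    · rw [← ha, hpa]
      exact (hAU u).2 (subset_convexHull ℝ _ hu)
    · rw [← hb, hpb, f.emb.norm_map]
      exact (ht w).trans ((hAW w).2 (subset_convexHull ℝ _ hw))
    · have hv1 := (hAV v).2 (subset_convexHull ℝ _ hv)
      rw [hdsymm, map_smul, map_sub, hpa, hpb, ← map_sub, norm_smul, f.emb.norm_map, norm_inv,
        Real.norm_of_nonneg hε'.le, inv_mul_le_iff₀ hε', norm_sub_rev]
      exact (hts v).trans (mul_le_mul_of_nonneg_left hv1 hε'.le))
  have hq1 : ∀ y, ‖q y‖ ≤ ‖y‖ := norm_map_le_of_symm_vertices hc q (by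
    rintro _ ((⟨u, hu, rfl⟩ | ⟨w, hw, rfl⟩) | ⟨v, hv, rfl⟩)
    · rw [← ha, hqa]
      exact (hs _).trans ((hproj u).trans ((hAU u).2 (subset_convexHull ℝ _ hu)))
    · rw [← hb, hqb]
      exact (hAW w).2 (subset_convexHull ℝ _ hw)
    · rw [hdsymm, map_smul, map_sub, hqa, hqb, f.proj_emb]
      simp)
  have hfst : ∀ v, ∃ u, fst (c (Y.ofRat v)) = U.ofRat u := fun v =>
    (U.exists_eq_ofRat_iff _).2 fun i => hcr v (Sum.inl i)
  have hsnd : ∀ v, ∃ u, snd (c (Y.ofRat v)) = W.ofRat u := fun v =>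
    (W.exists_eq_ofRat_iff _).2 fun i => hcr v (Sum.inr i)
  refine ⟨Y, .ofContractions a p ha1 hp1 hpa (fun v => hcr' _ (hinl v)) ?_,
    .ofContractions b q hb1 hq1 hqb (fun v => hcr' _ (hinr v)) ?_, ?_, hqa⟩
  · intro y
    obtain ⟨u, hu⟩ := hfst y
    obtain ⟨w, hw⟩ := hsnd y
    obtain ⟨v, hv⟩ := htr w
    obtain ⟨u', hu'⟩ := f.emb_rational v
    have : p (Y.ofRat y) = U.ofRat u + U.ofRat u' := by
      rw [← hu', ← hv, ← hw, ← hu]; rfl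
    rw [this]
    exact (U.exists_eq_ofRat_iff _).2 ((IsRationalVector.ratCast u).add (.ratCast u'))
  · intro y
    obtain ⟨u, hu⟩ := hfst y
    obtain ⟨w, hw⟩ := hsnd y
    obtain ⟨v, hv⟩ := f.proj_rational u
    obtain ⟨w', hw'⟩ := hsr v
    have : q (Y.ofRat y) = W.ofRat w' + W.ofRat w := by
      rw [← hw', ← hv, ← hw, ← hu]; rfl
    rw [this]
    exact (W.exists_eq_ofRat_iff _).2 ((IsRationalVector.ratCast w').add (.ratCast w))
  · intro v
    have h := hd1 v
    rw [hdsymm, norm_smul, norm_inv, Real.norm_of_nonneg hε'.le, inv_mul_le_iff₀ hε'] at h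
    exact h

/-! ### Rational approximations of a finite-dimensional decomposition -/

/-- The unit ball `B` of a norm on `ℝ ^ ι` (given by an injective map `A` into a normed space) can
be approximated from inside by a rational polytope containing `(1 - δ) B`. -/
theorem exists_rational_polytope {ι : Type*} [Fintype ι] {X : Type*} [NormedAddCommGroup X]
    [NormedSpace ℝ X] (A : (ι → ℝ) →ₗ[ℝ] X) (hA : Function.Injective A) {δ : ℝ} (hδ : 0 < δ)
    (hδ1 : δ < 1) :
    ∃ S : Set (ι → ℝ), S.Finite ∧ (∀ a ∈ S, IsRationalVector a) ∧ (∀ a ∈ S, ‖A a‖ ≤ 1) ∧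
      ∀ x, ‖A x‖ ≤ 1 - δ → x ∈ convexHull ℝ (S ∪ -S) := by
  have hAc : Continuous A := A.continuous_of_finiteDimensional
  let B : Set (ι → ℝ) := {x | ‖A x‖ ≤ 1}
  have hBc : IsCompact B := by
    obtain ⟨K, -, hK⟩ := A.exists_antilipschitzWith (LinearMap.ker_eq_bot.2 hA)
    have h1 : B = A ⁻¹' Metric.closedBall 0 1 := by ext; simp [B]
    rw [h1]
    exact Metric.isCompact_of_isClosed_isBounded (Metric.isClosed_closedBall.preimage hAc)
      (hK.isBounded_preimage Metric.isBounded_closedBall)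
  let Q : Set (ι → ℝ) := {q | IsRationalVector q ∧ ‖A q‖ < 1}
  -- A finite `δ`-net of `B` consisting of rational vectors of norm less than one.
  obtain ⟨S, hSQ, hSf, hS⟩ : ∃ S ⊆ Q, S.Finite ∧ B ⊆ ⋃ q ∈ S, {x | ‖A (x - q)‖ < δ} := by
    refine hBc.elim_finite_subcover_image (fun q _ => ?_) fun x hx => ?_
    · exact isOpen_lt (by fun_prop) continuous_const
    · have hx' : ‖A x‖ ≤ 1 := hx
      have hO : IsOpen {q : ι → ℝ | ‖A q‖ < 1 ∧ ‖A (x - q)‖ < δ} :=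
        (isOpen_lt (f := fun q => ‖A q‖) (by fun_prop) continuous_const).inter
          (isOpen_lt (f := fun q => ‖A (x - q)‖) (by fun_prop) continuous_const)
      have hne : {q : ι → ℝ | ‖A q‖ < 1 ∧ ‖A (x - q)‖ < δ}.Nonempty := by
        refine ⟨(1 - δ / 2) • x, ?_, ?_⟩
        · rw [map_smul, norm_smul, Real.norm_of_nonneg (by linarith)]
          nlinarith [norm_nonneg (A x)]
        · have : x - (1 - δ / 2) • x = (δ / 2) • x := by module
          rw [this, map_smul, norm_smul, Real.norm_of_nonneg (by linarith)]
          nlinarith [norm_nonneg (A x)]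
      have hd : DenseRange (fun (v : ι → ℚ) (i : ι) => (v i : ℝ)) :=
        DenseRange.piMap fun _ => Rat.denseRange_cast
      obtain ⟨v, hv1, hv2⟩ := hd.exists_mem_open hO hne
      exact Set.mem_biUnion (x := fun i => (v i : ℝ)) ⟨.ratCast v, hv1⟩ hv2
  refine ⟨S, hSf, fun a ha => (hSQ ha).1, fun a ha => (hSQ ha).2.le, fun x hx => ?_⟩
  by_contra hxS
  -- Separate `x` from the hull by `f`. If `y` maximises `f` on the ball and `q` is a point of the
  -- net close to `y`, then `f q ≥ (1 - δ) f y ≥ f x`, a contradiction.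
  obtain ⟨f, u, hfu, hfx⟩ := geometric_hahn_banach_closed_point (convex_convexHull ℝ (S ∪ -S))
    ((hSf.union hSf.neg).isClosed_convexHull ℝ) hxS
  obtain ⟨y, hyB, hy⟩ := hBc.exists_isMaxOn ⟨0, by simp [B]⟩ f.continuous.continuousOn
  have hscale : ∀ r : ℝ, 0 < r → ∀ z, ‖A z‖ ≤ r → f z ≤ r * f y := fun r hr z hz => by
    have h1 : r⁻¹ • z ∈ B := by
      change ‖A (r⁻¹ • z)‖ ≤ 1
      rw [map_smul, norm_smul, norm_inv, Real.norm_of_nonneg hr.le, inv_mul_le_one₀ hr]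
      exact hz
    have h2 : f (r⁻¹ • z) ≤ f y := hy h1
    rwa [map_smul, smul_eq_mul, inv_mul_le_iff₀ hr] at h2
  obtain ⟨q, hqS, hq⟩ := Set.mem_iUnion₂.1 (hS hyB)
  have h1 := hfu q (subset_convexHull ℝ _ (.inl hqS))
  have h2 := hscale δ hδ _ (le_of_lt hq)
  have h3 := hscale (1 - δ) (by linarith) x hx
  rw [map_sub] at h2
  linarith

/-- A norm on `ℝ ^ ι` is approximated up to the factor `1 - δ` by the norm of a rational space. -/
theorem exists_rationalSpace_approx {ι : Type*} [Fintype ι] {X : Type*} [NormedAddCommGroup X]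
    [NormedSpace ℝ X] (A : (ι → ℝ) →ₗ[ℝ] X) (hA : Function.Injective A) {δ : ℝ} (hδ : 0 < δ)
    (hδ1 : δ < 1) :
    ∃ (V : RationalSpace) (c : V.Carrier ≃ₗ[ℝ] (ι → ℝ)),
      (∀ v, IsRationalVector (c (V.ofRat v))) ∧
      (∀ x, IsRationalVector x → ∃ v, c.symm x = V.ofRat v) ∧
      (∀ x, ‖A (c x)‖ ≤ ‖x‖) ∧ ∀ x, (1 - δ) * ‖x‖ ≤ ‖A (c x)‖ := by
  obtain ⟨S, hSf, hSr, hS1, hS⟩ := exists_rational_polytope A hA hδ hδ1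
  have hAc : Continuous A := A.continuous_of_finiteDimensional
  have h0 : convexHull ℝ (S ∪ -S) ∈ 𝓝 (0 : ι → ℝ) := by
    have h : ∀ᶠ x in 𝓝 (0 : ι → ℝ), ‖A x‖ < 1 - δ :=
      (isOpen_lt (by fun_prop) continuous_const).mem_nhds (by simpa using hδ1)
    filter_upwards [h] with x hx using hS x hx.le
  obtain ⟨V, c, hc1, hc2, hc⟩ := exists_rationalSpace_of_vertices hSf hSr h0
  refine ⟨V, c, hc1, hc2, norm_map_le_of_symm_vertices hc (A ∘ₗ c.toLinearMap) fun a ha => ?_,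
    fun x => ?_⟩
  · simpa using hS1 a ha
  · rcases eq_or_ne x 0 with rfl | hx
    · simp
    have hpos : 0 < ‖A (c x)‖ := by
      rw [norm_pos_iff, Ne, map_eq_zero_iff A hA]
      simpa using hx
    have hδ' : 0 < 1 - δ := by linarith
    have h := (hc (((1 - δ) / ‖A (c x)‖) • x)).2 (hS _ (by
      rw [map_smul, map_smul, norm_smul, Real.norm_of_nonneg (by positivity)]
      exact (div_mul_cancel₀ _ hpos.ne').le))
    rwa [norm_smul, Real.norm_of_nonneg (by positivity), div_mul_eq_mul_div, div_le_one hpos] at h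

/-- The operators of a decomposition are idempotent. -/
theorem apply_apply_of_tendsto_sum {X : Type*} [NormedAddCommGroup X] [NormedSpace ℝ X]
    (P : ℕ → X →L[ℝ] X) (horth : ∀ n m, n ≠ m → ∀ x, P n (P m x) = 0)
    (hsum : ∀ x, Tendsto (fun N => ∑ n ∈ Finset.range N, P n x) atTop (𝓝 x)) (n : ℕ) (x : X) :
    P n (P n x) = P n x := by
  have h : Tendsto (fun N => ∑ j ∈ Finset.range N, P j (P n x)) atTop (𝓝 (P n (P n x))) := by
    refine tendsto_const_nhds.congr' ?_
    filter_upwards [eventually_gt_atTop n] with N hN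
    rw [Finset.sum_eq_single_of_mem n (Finset.mem_range.2 hN) fun j _ hj => horth j n hj x]
  exact tendsto_nhds_unique h (hsum _)

theorem sum_range_sum_range_of_le {X : Type*} [NormedAddCommGroup X] [NormedSpace ℝ X]
    (P : ℕ → X →L[ℝ] X) (horth : ∀ n m, n ≠ m → ∀ x, P n (P m x) = 0)
    (hsum : ∀ x, Tendsto (fun N => ∑ n ∈ Finset.range N, P n x) atTop (𝓝 x)) {n m : ℕ}
    (h : n ≤ m) (x : X) :
    ∑ i ∈ Finset.range m, P i (∑ j ∈ Finset.range n, P j x) = ∑ j ∈ Finset.range n, P j x := by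
  simp_rw [map_sum]
  rw [Finset.sum_comm]
  refine Finset.sum_congr rfl fun j hj => ?_
  rw [Finset.sum_eq_single_of_mem j (Finset.mem_range.2 ((Finset.mem_range.1 hj).trans_le h))
    fun i _ hi => horth i j hi x, apply_apply_of_tendsto_sum P horth hsum]

/-- Coordinates adapted to a monotone FDD. The partial sums `S n` of the decomposition factor as
`a n ∘ b n` through a Euclidean space, with `b m ∘ a n` rational for all `m` and `n`. -/
theorem exists_coordinates {X : Type*} [NormedAddCommGroup X] [NormedSpace ℝ X]
    (P : ℕ → X →L[ℝ] X) (hfin : ∀ n, FiniteDimensional ℝ (LinearMap.range (P n : X →ₗ[ℝ] X)))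
    (horth : ∀ n m, n ≠ m → ∀ x, P n (P m x) = 0)
    (hsum : ∀ x, Tendsto (fun N => ∑ n ∈ Finset.range N, P n x) atTop (𝓝 x)) :
    ∃ (r : ℕ → ℕ) (a : ∀ n, ((Σ j : Fin n, Fin (r j)) → ℝ) →ₗ[ℝ] X)
      (b : ∀ n, X →L[ℝ] ((Σ j : Fin n, Fin (r j)) → ℝ)),
      (∀ n x, a n (b n x) = ∑ j ∈ Finset.range n, P j x) ∧
      (∀ n u, b n (a n u) = u) ∧
      ∀ m n u, IsRationalVector u → IsRationalVector (b m (a n u)) := by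
  have hidem := apply_apply_of_tendsto_sum P horth hsum
  let r : ℕ → ℕ := fun n => Module.finrank ℝ (LinearMap.range (P n : X →ₗ[ℝ] X))
  let φ : ∀ n, LinearMap.range (P n : X →ₗ[ℝ] X) ≃L[ℝ] (Fin (r n) → ℝ) := fun n =>
    (Module.finBasis ℝ (LinearMap.range (P n : X →ₗ[ℝ] X))).equivFunL
  let c : ∀ n, (Fin (r n) → ℝ) →ₗ[ℝ] X := fun n =>
    (LinearMap.range (P n : X →ₗ[ℝ] X)).subtype ∘ₗ (φ n).symm.toLinearMap
  let k : ∀ n, X →L[ℝ] (Fin (r n) → ℝ) := fun n =>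
    (φ n).toContinuousLinearMap.comp
      ((P n).codRestrict (LinearMap.range (P n : X →ₗ[ℝ] X)) fun x => ⟨x, rfl⟩)
  have hck : ∀ n x, c n (k n x) = P n x := fun n x => by
    change ((φ n).symm (φ n ⟨P n x, x, rfl⟩) : X) = P n x
    rw [(φ n).symm_apply_apply]
  have hPc : ∀ n u, P n (c n u) = c n u := fun n u => by
    obtain ⟨x, hx⟩ := ((φ n).symm u).2
    change P n ((φ n).symm u : X) = ((φ n).symm u : X)
    rw [← hx]
    exact hidem n x
  have hcinj : ∀ n, Function.Injective (c n) := fun n u v h =>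
    (φ n).symm.injective (Subtype.ext h)
  have hkc : ∀ n u, k n (c n u) = u := fun n u => hcinj n (by rw [hck, hPc])
  have hkc0 : ∀ m n, m ≠ n → ∀ u, k m (c n u) = 0 := fun m n hmn u =>
    hcinj m (by rw [hck, ← hPc n, horth m n hmn, map_zero])
  let a : ∀ n, ((Σ j : Fin n, Fin (r j)) → ℝ) →ₗ[ℝ] X := fun n =>
    ∑ j : Fin n, c j ∘ₗ LinearMap.funLeft ℝ ℝ (fun i => (⟨j, i⟩ : Σ j : Fin n, Fin (r j)))
  have ha : ∀ n u, a n u = ∑ j : Fin n, c j (fun i => u ⟨j, i⟩) := fun n u => by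
    simp [a]; rfl
  let b : ∀ n, X →L[ℝ] ((Σ j : Fin n, Fin (r j)) → ℝ) := fun n =>
    ContinuousLinearMap.pi fun i => (ContinuousLinearMap.proj i.2).comp (k i.1)
  have hb : ∀ n x i, b n x i = k i.1 x i.2 := fun _ _ _ => rfl
  have hba : ∀ m n u (j : Fin m) i, b m (a n u) ⟨j, i⟩ =
      if h : (j : ℕ) < n then u ⟨⟨j, h⟩, i⟩ else 0 := fun m n u j i => by
    rw [hb, ha, map_sum, Finset.sum_apply]
    split_ifs with h
    · rw [Finset.sum_eq_single (⟨j, h⟩ : Fin n)]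
      · rw [hkc]
      · intro l _ hl
        rw [hkc0 _ _ (fun h' => hl (Fin.ext h'.symm))]
        rfl
      · simp
    · refine Finset.sum_eq_zero fun l _ => ?_
      rw [hkc0 _ _ (fun h' : (j : ℕ) = l => h (h' ▸ l.2))]
      rfl
  refine ⟨r, a, b, fun n x => ?_, fun n u => ?_, fun m n u hu => ?_⟩
  · rw [ha, Finset.sum_range]
    exact Finset.sum_congr rfl fun j _ => hck j x
  · ext ⟨j, i⟩
    rw [hba, dif_pos j.2]
  · rintro ⟨j, i⟩
    rw [hba]
    split_ifs with h
    · exact hu _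
    · exact ⟨0, by simp⟩

/-- A monotone FDD is approximated by rational spaces `V n`: up to the factor `1 - δ n`, the
contractions `J n` and `K n` identify `V n` with the range of the `n`-th partial sum. -/
theorem exists_rationalSpace_sequence {X : Type*} [NormedAddCommGroup X] [NormedSpace ℝ X]
    (P : ℕ → X →L[ℝ] X) (hfin : ∀ n, FiniteDimensional ℝ (LinearMap.range (P n : X →ₗ[ℝ] X)))
    (horth : ∀ n m, n ≠ m → ∀ x, P n (P m x) = 0)
    (hsum : ∀ x, Tendsto (fun N => ∑ n ∈ Finset.range N, P n x) atTop (𝓝 x))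
    (hmono : ∀ N, ‖∑ n ∈ Finset.range N, P n‖ ≤ 1) (δ : ℕ → ℚ) (hδ : ∀ n, 0 < δ n)
    (hδ1 : ∀ n, δ n < 1) :
    ∃ (V : ℕ → RationalSpace) (J : ∀ n, (V n).Carrier →L[ℝ] X) (K : ∀ n, X →L[ℝ] (V n).Carrier),
      (∀ n v, ‖J n v‖ ≤ ‖v‖) ∧ (∀ n x, ‖K n x‖ ≤ ‖x‖) ∧
      (∀ n x, J n (K n x) = (1 - δ n : ℝ) • ∑ j ∈ Finset.range n, P j x) ∧
      (∀ n v, K n (J n v) = (1 - δ n : ℝ) • v) ∧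
      ∀ m n, RationalSpace.IsRationalMap (fun v => K m (J n v)) := by
  obtain ⟨r, a, b, hab, hba, hr⟩ := exists_coordinates P hfin horth hsum
  have hainj : ∀ n, Function.Injective (a n) := fun n =>
    Function.LeftInverse.injective (hba n)
  choose V c hc1 hc2 hc3 hc4 using fun n => exists_rationalSpace_approx (a n) (hainj n)
    (δ := (δ n : ℝ)) (by exact_mod_cast hδ n) (by exact_mod_cast hδ1 n)
  have hpos : ∀ n, (0 : ℝ) < 1 - δ n := fun n => by
    have : (δ n : ℝ) < 1 := by exact_mod_cast hδ1 n
    linarith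
  let J : ∀ n, (V n).Carrier →L[ℝ] X := fun n => LinearMap.toContinuousLinearMap
    (a n ∘ₗ (c n).toLinearMap)
  let K : ∀ n, X →L[ℝ] (V n).Carrier := fun n => (1 - δ n : ℝ) •
    ((LinearMap.toContinuousLinearMap (c n).symm.toLinearMap).comp (b n))
  have hJ : ∀ n v, J n v = a n (c n v) := fun _ _ => rfl
  have hK : ∀ n x, K n x = (1 - δ n : ℝ) • (c n).symm (b n x) := fun _ _ => rfl
  refine ⟨V, J, K, hc3, fun n x => ?_, fun n x => ?_, fun n v => ?_, fun m n v => ?_⟩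
  · rw [hK, norm_smul, Real.norm_of_nonneg (hpos n).le]
    refine (hc4 n _).trans ?_
    rw [(c n).apply_symm_apply, hab]
    simpa using (∑ j ∈ Finset.range n, P j).le_of_opNorm_le (hmono n) x
  · rw [hK, map_smul, hJ, (c n).apply_symm_apply, hab]
  · rw [hK, hJ, hba, (c n).symm_apply_apply]
  · have h1 := (hr m n _ (hc1 n v)).smul (1 - δ m)
    obtain ⟨w, hw⟩ := hc2 m _ h1
    refine ⟨w, ?_⟩
    beta_reduce
    rw [← hw, hK, hJ, map_smul]
    push_cast
    rfl

/-! ### The limit of a sequence of pairs -/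

/-- The bonding projections `U m → U n` of a sequence. -/
noncomputable def bondProj (U : ℕ ⥤ RationalSpace) (n m : ℕ) (h : n ≤ m) :
    (U.obj m).Carrier →L[ℝ] (U.obj n).Carrier :=
  RationalPair.toProjEmbPair (U.map (homOfLE h)) |>.proj

section Bonding

variable (U : ℕ ⥤ RationalSpace)

theorem bondProj_bondEmb {n m : ℕ} (h : n ≤ m) (x : (U.obj n).Carrier) :
    bondProj U n m h (bondEmb U n m h x) = x :=
  (RationalPair.toProjEmbPair (U.map (homOfLE h))).proj_emb x

theorem bondEmb_bondEmb {n m k : ℕ} (h : n ≤ m) (h' : m ≤ k) (x : (U.obj n).Carrier) :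
    bondEmb U m k h' (bondEmb U n m h x) = bondEmb U n k (h.trans h') x :=
  DirectedSystem.map_map (f := fun n m h => bondEmb U n m h) h h' x

theorem bondProj_bondProj {n m k : ℕ} (h : n ≤ m) (h' : m ≤ k) (x : (U.obj k).Carrier) :
    bondProj U n m h (bondProj U m k h' x) = bondProj U n k (h.trans h') x := by
  have e : U.map (homOfLE (h.trans h')) = U.map (homOfLE h) ≫ U.map (homOfLE h') :=
    U.map_comp (homOfLE h) (homOfLE h')
  change _ = (RationalPair.toProjEmbPair (U.map (homOfLE (h.trans h')))).proj x
  rw [e]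
  rfl

theorem norm_bondProj_le {n m : ℕ} (h : n ≤ m) (x : (U.obj m).Carrier) :
    ‖bondProj U n m h x‖ ≤ ‖x‖ :=
  (ContinuousLinearMap.le_of_opNorm_le _
    (RationalPair.toProjEmbPair (U.map (homOfLE h))).norm_proj_le x).trans_eq (one_mul _)

/-- The canonical embedding of a term of the sequence into the union of the chain. -/
noncomputable def chainEmb (n : ℕ) : (U.obj n).Carrier →ₗᵢ[ℝ] ChainUnion U where
  toLinearMap := DirectLimit.Module.of ℝ ℕ (fun n => (U.obj n).Carrier) (bondEmb U) n
  norm_map' _ := rfl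

theorem chainEmb_bondEmb {n m : ℕ} (h : n ≤ m) (x : (U.obj n).Carrier) :
    chainEmb U m (bondEmb U n m h x) = chainEmb U n x :=
  DirectLimit.Module.of_f (R := ℝ) (ι := ℕ) (G := fun n => (U.obj n).Carrier) (f := bondEmb U)

theorem exists_chainEmb_eq (z : ChainUnion U) : ∃ n x, chainEmb U n x = z := by
  induction z using DirectLimit.induction with
  | ih n x => exact ⟨n, x, rfl⟩

/-- The canonical projection of the union of the chain onto its `n`-th term. On the `m`-th term it
goes up to the level `max n m` and from there down to the level `n`. -/
noncomputable def chainProj (n : ℕ) : ChainUnion U →ₗ[ℝ] (U.obj n).Carrier :=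
  DirectLimit.Module.lift ℝ ℕ (fun n => (U.obj n).Carrier) (bondEmb U)
    (fun m => (bondProj U n (max n m) (le_max_left n m)).toLinearMap ∘ₗ
      (bondEmb U m (max n m) (le_max_right n m)).toLinearMap)
    (fun m k h x => by
      change bondProj U n (max n k) _ (bondEmb U k (max n k) _ (bondEmb U m k h x)) =
        bondProj U n (max n m) _ (bondEmb U m (max n m) _ x)
      have hmk : max n m ≤ max n k := max_le_max le_rfl h
      rw [bondEmb_bondEmb, ← bondEmb_bondEmb U (le_max_right n m) hmk,
        ← bondProj_bondProj U (le_max_left n m) hmk, bondProj_bondEmb])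

theorem chainProj_chainEmb_eq (n m : ℕ) (x : (U.obj m).Carrier) :
    chainProj U n (chainEmb U m x) = bondProj U n (max n m) (le_max_left n m)
      (bondEmb U m (max n m) (le_max_right n m) x) := rfl

theorem chainProj_chainEmb (n : ℕ) (x : (U.obj n).Carrier) :
    chainProj U n (chainEmb U n x) = x := by
  rw [← chainEmb_bondEmb U (le_max_left n n) x, chainProj_chainEmb_eq, bondEmb_bondEmb,
    ← bondEmb_bondEmb U (le_max_left n n) (le_max_right n (max n n))]
  have h : max n n ≤ max n (max n n) := le_max_right _ _
  rw [← bondProj_bondProj U (le_max_left n n) h, bondProj_bondEmb, bondProj_bondEmb]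

theorem norm_chainProj_le (n : ℕ) (z : ChainUnion U) : ‖chainProj U n z‖ ≤ ‖z‖ := by
  obtain ⟨m, x, rfl⟩ := exists_chainEmb_eq U z
  rw [chainProj_chainEmb_eq, (chainEmb U m).norm_map]
  exact (norm_bondProj_le U _ _).trans (LinearIsometry.norm_map _ _).le

end Bonding

/-- Contractions that converge pointwise on a dense set converge pointwise to a contraction. -/
theorem exists_tendsto_of_contractions {E F : Type*} [NormedAddCommGroup E] [NormedSpace ℝ E]
    [NormedAddCommGroup F] [NormedSpace ℝ F] [CompleteSpace F] (T : ℕ → E →ₗ[ℝ] F)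
    (hT : ∀ n x, ‖T n x‖ ≤ ‖x‖) {D : Set E} (hD : Dense D)
    (hc : ∀ x ∈ D, CauchySeq fun n => T n x) :
    ∃ S : E →L[ℝ] F, (∀ x, ‖S x‖ ≤ ‖x‖) ∧ ∀ x, Tendsto (fun n => T n x) atTop (𝓝 (S x)) := by
  have hcauchy : ∀ x, CauchySeq fun n => T n x := fun x => by
    refine Metric.cauchySeq_iff'.2 fun ε hε => ?_
    obtain ⟨y, hy, hyD⟩ := hD.exists_dist_lt x (show 0 < ε / 3 by positivity)
    obtain ⟨N, hN⟩ := Metric.cauchySeq_iff'.1 (hc y hy) (ε / 3) (by positivity)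
    refine ⟨N, fun n hn => ?_⟩
    have h : ∀ m, dist (T m x) (T m y) < ε / 3 := fun m => by
      rw [dist_eq_norm, ← map_sub]
      exact (hT m _).trans_lt (by rwa [← dist_eq_norm])
    have h1 := h n
    have h2 := h N
    rw [dist_comm] at h2
    linarith [hN n hn, dist_triangle4 (T n x) (T n y) (T N y) (T N x)]
  choose S hS using fun x => cauchySeq_tendsto_of_complete (hcauchy x)
  have hSn : ∀ x, ‖S x‖ ≤ ‖x‖ := fun x => le_of_tendsto' (hS x).norm fun n => hT n x
  let S' : E →ₗ[ℝ] F :=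
    { toFun := S
      map_add' := fun x y => tendsto_nhds_unique (hS (x + y))
        (((hS x).add (hS y)).congr fun n => (map_add (T n) x y).symm)
      map_smul' := fun r x => tendsto_nhds_unique (hS (r • x))
        (((hS x).const_smul r).congr fun n => (map_smul (T n) r x).symm) }
  exact ⟨S'.mkContinuous 1 fun x => (hSn x).trans_eq (one_mul _).symm, hSn, hS⟩

/-- A sequence whose increments are eventually dominated by a geometric sequence of ratio `1/2` is a
Cauchy sequence. -/
theorem cauchySeq_of_eventually_dist_le_half_pow {F : Type*} [SeminormedAddCommGroup F]
    {x : ℕ → F} {C : ℝ} (N : ℕ) (h : ∀ n ≥ N, ‖x (n + 1) - x n‖ ≤ C * (1 / 2) ^ n) :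
    CauchySeq x := by
  rw [← cauchySeq_shift N]
  refine cauchySeq_of_le_geometric (1 / 2) (C * (1 / 2) ^ N) (by norm_num) fun n => ?_
  rw [dist_comm, dist_eq_norm]
  have := h (n + N) (by omega)
  rw [pow_add] at this
  rw [show n + 1 + N = n + N + 1 by ring]
  calc _ ≤ _ := this
    _ = _ := by ring

/-! ### Arrows into a Fraïssé sequence -/

/-- Let `V n` be rational spaces which, up to small errors, form a sequence of arrows
`(s n, t n)` starting from the trivial space. Then there are arrows from the `V n` to terms of a
given Fraïssé sequence that are almost compatible on the embeddings, and exactly compatible on the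
projections restricted to the image of the preceding term. -/
theorem IsFraisseSequence.exists_arrows {U : ℕ ⥤ RationalSpace} (hU : IsFraisseSequence U)
    (V : ℕ → RationalSpace) [Subsingleton (V 0).Carrier]
    (s : ∀ n, (V n).Carrier →ₗ[ℝ] (V (n + 1)).Carrier)
    (t : ∀ n, (V (n + 1)).Carrier →ₗ[ℝ] (V n).Carrier)
    (hs : ∀ n v, ‖s n v‖ ≤ ‖v‖) (ht : ∀ n v, ‖t n v‖ ≤ ‖v‖)
    (hsr : ∀ n, RationalSpace.IsRationalMap (s n)) (htr : ∀ n, RationalSpace.IsRationalMap (t n))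
    (ε : ℕ → ℚ) (hε : ∀ n, 0 < ε n) (hts : ∀ n v, ‖t n (s n v) - v‖ ≤ ε n * ‖v‖) :
    ∃ (k : ℕ → ℕ) (hk : StrictMono k) (f : ∀ n, RationalPair (V n) (U.obj (k n))),
      (∀ n v, ‖bondEmb U (k n) (k (n + 1)) (hk.monotone n.le_succ) ((f n).emb v) -
        (f (n + 1)).emb (s n v)‖ ≤ ε n * ‖v‖) ∧
      ∀ n u, (f (n + 1)).proj (bondEmb U (k n) (k (n + 1)) (hk.monotone n.le_succ) u) =
        s n ((f n).proj u) := by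
  have step : ∀ n (p : Σ k, RationalPair (V n) (U.obj k)),
      ∃ (q : Σ k, RationalPair (V (n + 1)) (U.obj k)) (h : p.1 < q.1),
        (∀ v, ‖bondEmb U p.1 q.1 h.le (p.2.emb v) - q.2.emb (s n v)‖ ≤ ε n * ‖v‖) ∧
        ∀ u, q.2.proj (bondEmb U p.1 q.1 h.le u) = s n (p.2.proj u) := by
    rintro n ⟨k, f⟩
    obtain ⟨Y, g, h, hgh, hhg⟩ := exists_approximate_amalgam f (s n) (t n) (hs n) (ht n) (hsr n)
      (htr n) (hε n) (hts n)
    obtain ⟨m, hm, g', hg'⟩ := hU k Y g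
    have hb : ∀ u, bondEmb U k m hm.le u = (RationalPair.toProjEmbPair g').emb (g.emb u) :=
      fun u => by
        change (RationalPair.toProjEmbPair (U.map (homOfLE hm.le))).emb u = _
        rw [← hg']
        rfl
    let h' : V (n + 1) ⟶ Y := h
    refine ⟨⟨m, (h' ≫ g' : V (n + 1) ⟶ U.obj m)⟩, hm, fun v => ?_, fun u => ?_⟩
    · change ‖bondEmb U k m hm.le (f.emb v) -
        (RationalPair.toProjEmbPair g').emb (h.emb (s n v))‖ ≤ _
      rw [hb, ← map_sub, LinearIsometry.norm_map]
      exact hgh v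
    · change h.proj ((RationalPair.toProjEmbPair g').proj (bondEmb U k m hm.le u)) = _
      rw [hb, ProjEmbPair.proj_emb]
      exact hhg u
  let p₀ : Σ k, RationalPair (V 0) (U.obj k) := ⟨0, .ofContractions 0 0 (by simp) (by simp)
    (fun _ => Subsingleton.elim _ _) (fun _ => ⟨0, funext fun _ => Rat.cast_zero.symm⟩)
    fun _ => ⟨0, Subsingleton.elim _ _⟩⟩
  choose F hF1 hF2 hF3 using step
  let p : ∀ n, Σ k, RationalPair (V n) (U.obj k) := fun n => Nat.rec p₀ F n
  exact ⟨fun n => (p n).1, strictMono_nat_of_lt_succ fun n => hF1 n (p n), fun n => (p n).2,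
    fun n => hF2 n (p n), fun n => hF3 n (p n)⟩

/-! ### Universality -/

theorem ContinuousLinearMap.norm_fromCompletion_le {E F : Type*} [NormedAddCommGroup E]
    [NormedSpace ℝ E] [NormedAddCommGroup F] [NormedSpace ℝ F] [CompleteSpace F] (T : E →L[ℝ] F)
    (hT : ∀ x, ‖T x‖ ≤ ‖x‖) (z : UniformSpace.Completion E) : ‖T.fromCompletion z‖ ≤ ‖z‖ := by
  induction z using UniformSpace.Completion.induction_on with
  | hp => exact isClosed_le (by fun_prop) (by fun_prop)
  | ih x => simpa using hT x

/-- If contractions `T n : X → Z` and `Q n : Z → X` converge pointwise on dense sets and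
`Q n ∘ T n` converges pointwise to the identity, then the limits embed `X` isometrically as a
1-complemented subspace of `Z`. -/
theorem exists_isometry_isOneComplemented {X Z : Type*} [NormedAddCommGroup X] [NormedSpace ℝ X]
    [CompleteSpace X] [NormedAddCommGroup Z] [NormedSpace ℝ Z] [CompleteSpace Z]
    (T : ℕ → X →ₗ[ℝ] Z) (Q : ℕ → Z →ₗ[ℝ] X) (hT : ∀ n x, ‖T n x‖ ≤ ‖x‖)
    (hQ : ∀ n z, ‖Q n z‖ ≤ ‖z‖) {D : Set X} (hD : Dense D)
    (hTc : ∀ x ∈ D, CauchySeq fun n => T n x) {D' : Set Z} (hD' : Dense D')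
    (hQc : ∀ z ∈ D', CauchySeq fun n => Q n z)
    (hQT : ∀ x, Tendsto (fun n => Q n (T n x)) atTop (𝓝 x)) :
    ∃ e : X →ₗᵢ[ℝ] Z, IsOneComplemented (LinearMap.range e.toLinearMap) := by
  obtain ⟨e, he, hTe⟩ := exists_tendsto_of_contractions T hT hD hTc
  obtain ⟨R, hR, hQR⟩ := exists_tendsto_of_contractions Q hQ hD' hQc
  have hRe : ∀ x, R (e x) = x := fun x => by
    have h1 : Tendsto (fun n => Q n (T n x) - Q n (e x)) atTop (𝓝 0) := by
      refine squeeze_zero_norm (fun n => ?_) (tendsto_iff_norm_sub_tendsto_zero.1 (hTe x))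
      rw [← map_sub]
      exact hQ n _
    have h2 := (hQT x).sub h1
    simp only [sub_sub_cancel, sub_zero] at h2
    exact tendsto_nhds_unique (hQR (e x)) h2
  refine ⟨⟨e.toLinearMap, fun x => le_antisymm (he x) ?_⟩, e.comp R, ?_, fun z => ⟨R z, rfl⟩, ?_⟩
  · simpa [hRe] using hR (e x)
  · exact ContinuousLinearMap.opNorm_le_bound _ zero_le_one fun z =>
      ((he _).trans (hR z)).trans_eq (one_mul _).symm
  · rintro _ ⟨x, rfl⟩
    exact congrArg e (hRe x)

theorem mainTheorem1 (U : ℕ ⥤ RationalSpace) (hU : IsFraisseSequence U)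
    (X : Type*) [NormedAddCommGroup X] [NormedSpace ℝ X] [CompleteSpace X]
    (hX : HasMonotoneFDD X) :
    ∃ e : X →ₗᵢ[ℝ] LimitSpace U, IsOneComplemented (LinearMap.range e.toLinearMap) := by
  obtain ⟨P, hfin, horth, hsum, hmono⟩ := hX
  let δ : ℕ → ℚ := fun n => (1 / 2) ^ (n + 1)
  have hδ : ∀ n, 0 < δ n := fun n => by positivity
  have hδ1 : ∀ n, δ n < 1 := fun n => pow_lt_one₀ (by norm_num) (by norm_num) n.succ_ne_zero
  have hδR : ∀ n, (δ n : ℝ) = (1 / 2) ^ (n + 1) := fun n => by simp [δ]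
  obtain ⟨V, J, K, hJ, hK, hJK, hKJ, hKJr⟩ :=
    exists_rationalSpace_sequence P hfin horth hsum hmono δ hδ hδ1
  have hδ0 : ∀ n, (1 - δ n : ℝ) ≠ 0 := fun n => by
    have : (δ n : ℝ) < 1 := by exact_mod_cast hδ1 n
    linarith
  have hSJ : ∀ n m, n ≤ m → ∀ v, ∑ j ∈ Finset.range m, P j (J n v) = J n v := by
    intro n m hnm v
    have h1 : J n v = ∑ j ∈ Finset.range n, P j (J n v) := by
      have h := hJK n (J n v)
      rw [hKJ, map_smul] at h
      exact smul_right_injective X (hδ0 n) h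
    rw [h1]
    exact sum_range_sum_range_of_le P horth hsum hnm _
  have hJKJ : ∀ n v, J (n + 1) (K (n + 1) (J n v)) = (1 - δ (n + 1) : ℝ) • J n v := fun n v => by
    rw [hJK, hSJ n (n + 1) n.le_succ]
  -- The zeroth partial sum is `0`, so `V 0` is trivial.
  have hV0 : ∀ v : (V 0).Carrier, v = 0 := fun v => by
    have h1 : J 0 v = 0 := by simpa using (hSJ 0 0 le_rfl v).symm
    have h2 := hKJ 0 v
    rw [h1, map_zero] at h2
    exact (smul_eq_zero_iff_right (hδ0 0)).1 h2.symm
  have : Subsingleton (V 0).Carrier := ⟨fun v w => (hV0 v).trans (hV0 w).symm⟩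
  -- The composite `K n ∘ J (n + 1) ∘ K (n + 1) ∘ J n` is multiplication by
  -- `(1 - δ n) (1 - δ (n + 1))`, which differs from `1` by less than
  -- `δ n + δ (n + 1) ≤ (1 / 2) ^ n`.
  obtain ⟨k, hk, f, hf1, hf2⟩ := hU.exists_arrows V
    (fun n => (K (n + 1)).toLinearMap ∘ₗ (J n).toLinearMap)
    (fun n => (K n).toLinearMap ∘ₗ (J (n + 1)).toLinearMap)
    (fun n v => (hK _ _).trans (hJ _ _)) (fun n v => (hK _ _).trans (hJ _ _))
    (fun n => hKJr _ _) (fun n => hKJr _ _) (fun n => (1 / 2) ^ n) (fun n => by positivity)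
    (fun n v => by
      change ‖K n (J (n + 1) (K (n + 1) (J n v))) - v‖ ≤ _
      have : (1 - δ (n + 1) : ℝ) • (1 - δ n : ℝ) • v - v =
          (-(δ n + δ (n + 1) - δ n * δ (n + 1)) : ℝ) • v := by module
      rw [hJKJ, map_smul, hKJ, this, norm_smul]
      refine mul_le_mul_of_nonneg_right ?_ (norm_nonneg v)
      rw [norm_neg, hδR, hδR]
      push_cast
      have h0 : (0 : ℝ) < (1 / 2) ^ n := by positivity
      have h1 : ((1 : ℝ) / 2) ^ n ≤ 1 := pow_le_one₀ (by norm_num) (by norm_num)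
      rw [pow_succ, pow_succ, pow_succ]
      generalize ((1 : ℝ) / 2) ^ n = a at h0 h1
      rw [Real.norm_of_nonneg] <;> nlinarith)
  have hfp : ∀ n u, ‖(f n).proj u‖ ≤ ‖u‖ := fun n u =>
    ((f n).proj.le_of_opNorm_le (f n).norm_proj_le u).trans_eq (one_mul _)
  let z : ∀ n, X →ₗ[ℝ] ChainUnion U := fun n =>
    (chainEmb U (k n)).toLinearMap ∘ₗ (f n).emb.toLinearMap ∘ₗ (K n).toLinearMap
  have hz : ∀ n x, z n x = chainEmb U (k n) ((f n).emb (K n x)) := fun _ _ => rfl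
  let q : ∀ n, ChainUnion U →ₗ[ℝ] X := fun n =>
    (J n).toLinearMap ∘ₗ (f n).proj.toLinearMap ∘ₗ chainProj U (k n)
  have hq : ∀ n y, q n y = J n ((f n).proj (chainProj U (k n) y)) := fun _ _ => rfl
  have hq1 : ∀ n y, ‖q n y‖ ≤ ‖y‖ := fun n y =>
    (hJ _ _).trans ((hfp _ _).trans (norm_chainProj_le U _ _))
  let q' : ∀ n, ChainUnion U →L[ℝ] X := fun n =>
    (q n).mkContinuous 1 fun y => (hq1 n y).trans_eq (one_mul _).symm
  have hq' : ∀ n (y : ChainUnion U), (q' n).fromCompletion (y : LimitSpace U) = q n y :=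
    fun n y => (q' n).fromCompletion_apply_coe y
  refine exists_isometry_isOneComplemented (Z := LimitSpace U)
    (fun n => (UniformSpace.Completion.toComplₗᵢ (𝕜 := ℝ)).toLinearMap ∘ₗ z n)
    (fun n => (q' n).fromCompletion.toLinearMap) (fun n x => ?_)
    (fun n y => (q' n).norm_fromCompletion_le (hq1 n) y)
    (D := {x | ∃ m, ∀ n ≥ m, ∑ j ∈ Finset.range n, P j x = x}) (fun x => ?_) ?_
    (D' := Set.range ((↑) : ChainUnion U → LimitSpace U)) UniformSpace.Completion.denseRange_coe
    ?_ fun x => ?_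
  · change ‖(z n x : LimitSpace U)‖ ≤ ‖x‖
    rw [UniformSpace.Completion.norm_coe, hz, LinearIsometry.norm_map, LinearIsometry.norm_map]
    exact hK n x
  · exact mem_closure_of_tendsto (hsum x) (.of_forall fun m =>
      ⟨m, fun n hn => sum_range_sum_range_of_le P horth hsum hn x⟩)
  · rintro x ⟨m, hm⟩
    refine cauchySeq_of_eventually_dist_le_half_pow (C := 2 * ‖x‖) m fun n hn => ?_
    change ‖(z (n + 1) x : LimitSpace U) - (z n x : LimitSpace U)‖ ≤ _
    rw [← UniformSpace.Completion.coe_sub, UniformSpace.Completion.norm_coe, hz, hz,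
      ← chainEmb_bondEmb U (hk.monotone n.le_succ), ← map_sub, LinearIsometry.norm_map,
      norm_sub_rev]
    -- From the level `m` on, `K (n + 1) (J n (K n x))` is `(1 - δ n) • K (n + 1) x`.
    have h1 := hf1 n (K n x)
    have h2 : K (n + 1) (J n (K n x)) = K (n + 1) x - (δ n : ℝ) • K (n + 1) x := by
      rw [hJK, hm n hn, map_smul]
      module
    change ‖_ - (f (n + 1)).emb (K (n + 1) (J n (K n x)))‖ ≤ _ at h1
    rw [h2, map_sub, map_smul, ← sub_add] at h1
    have h3 : ‖(δ n : ℝ) • (f (n + 1)).emb (K (n + 1) x)‖ ≤ (1 / 2) ^ n * ‖x‖ := by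
      rw [norm_smul, LinearIsometry.norm_map, hδR, Real.norm_of_nonneg (by positivity)]
      refine mul_le_mul ?_ (hK _ _) (norm_nonneg _) (by positivity)
      exact pow_le_pow_of_le_one (by norm_num) (by norm_num) n.le_succ
    have h4 : (((1 / 2 : ℚ) ^ n : ℚ) : ℝ) * ‖K n x‖ ≤ (1 / 2) ^ n * ‖x‖ := by
      push_cast
      exact mul_le_mul_of_nonneg_left (hK n x) (by positivity)
    have h5 := norm_le_add_norm_add
      (bondEmb U (k n) (k (n + 1)) (hk.monotone n.le_succ) ((f n).emb (K n x)) -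
        (f (n + 1)).emb (K (n + 1) x)) ((δ n : ℝ) • (f (n + 1)).emb (K (n + 1) x))
    linarith
  · rintro _ ⟨y, rfl⟩
    obtain ⟨m, u, rfl⟩ := exists_chainEmb_eq U y
    refine cauchySeq_of_eventually_dist_le_half_pow (C := ‖u‖) m fun n hn => ?_
    change ‖(q' (n + 1)).fromCompletion _ - (q' n).fromCompletion _‖ ≤ _
    have hmk : m ≤ k n := hn.trans (hk.id_le n)
    rw [hq', hq', ← chainEmb_bondEmb U hmk]
    set w := bondEmb U m (k n) hmk u with hw
    -- On `U (k n)` the passage from `q n` to `q (n + 1)` is multiplication by `1 - δ (n + 1)`.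
    have h1 : q n (chainEmb U (k n) w) = J n ((f n).proj w) := by
      rw [hq, chainProj_chainEmb]
    have h2 : q (n + 1) (chainEmb U (k n) w) = (1 - δ (n + 1) : ℝ) • J n ((f n).proj w) := by
      rw [hq, ← chainEmb_bondEmb U (hk.monotone n.le_succ), chainProj_chainEmb, hf2]
      exact hJKJ n _
    have h3 : (1 - δ (n + 1) : ℝ) • J n ((f n).proj w) - J n ((f n).proj w) =
        (-δ (n + 1) : ℝ) • J n ((f n).proj w) := by module
    rw [h1, h2, h3, norm_smul, norm_neg, hδR, Real.norm_of_nonneg (by positivity), mul_comm]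
    refine mul_le_mul ?_ ?_ (by positivity) (norm_nonneg _)
    · exact ((hJ _ _).trans (hfp _ _)).trans_eq (by rw [hw, LinearIsometry.norm_map])
    · exact pow_le_pow_of_le_one (by norm_num) (by norm_num) (by omega)
  · have h1 : ∀ n, (q' n).fromCompletion (z n x : LimitSpace U) =
        (1 - δ n : ℝ) • ∑ j ∈ Finset.range n, P j x := fun n => by
      rw [hq', hq, hz, chainProj_chainEmb, ProjEmbPair.proj_emb, hJK]
    have h2 : Tendsto (fun n => (1 - δ n : ℝ)) atTop (𝓝 1) := by
      simp_rw [hδR]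
      have := ((tendsto_add_atTop_iff_nat 1).2
        (tendsto_pow_atTop_nhds_zero_of_lt_one (r := (1 / 2 : ℝ)) (by norm_num)
          (by norm_num))).const_sub 1
      simpa using this
    have h3 := h2.smul (hsum x)
    rw [one_smul] at h3
    exact h3.congr fun n => (h1 n).symm
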